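/- Let $G$ be a (real, finite-dimensional) Lie group, let $\mathrm{Lie}(G)\cong T_eG$ carry the bracket of left-invariant vector fields, and let $\exp:\mathrm{Lie}(G)\to G$ be the exponential map, i.e. $\exp(\xi)=\gamma(1)$, where $\gamma$ is the integral curve of the left-invariant vector field $\xi$ with $\gamma(0)=e$. Let $\pi:E\to\mathcal M$ be a smooth real vector bundle of finite rank over a smooth finite-dimensional manifold, and let $\Theta:E\times G\to E$ be a smooth fiber-linear right action: a smooth right $G$-action such that every $\Theta_g=\Theta(\cdot,g)$ is a vector bundle homomorphism, i.e. covers a map $\theta_g:\mathcal M\to\mathcal M$ and restricts to linear maps $E_p\to E_{\theta_g(p)}$. Let $\Sigma(E)$ be the vector space of all (possibly rough) sections of $E$ with the topology of pointwise convergence. For $g\in G$ and $F\in\Sigma(E)$ put $\mathcal K_gF=\Theta_{g^{-1}}\circ F\circ\theta_g\in\Sigma(E)$. For $\xi\in\mathrm{Lie}(G)$ the Lie derivative is $$\mathcal L_\xi F=\left.\frac{d}{dt}\right|_{t=0}\mathcal K_{\exp(t\xi)}F=\lim_{t\to0}\frac1t\left(\mathcal K_{\exp(t\xi)}F-F\right),$$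 with domain $D(\mathcal L_\xi)\subset\Sigma(E)$ the set of those sections $F$ for which the limit exists in $\Sigma(E)$. Then for all $\xi,\eta\in\mathrm{Lie}(G)$ and $\alpha,\beta,t\in\mathbb R$: 1. If $F\in D(\mathcal L_\xi)$, then $\mathcal K_{\exp(t\xi)}F\in D(\mathcal L_\xi)$, the curve $t\mapsto\mathcal K_{\exp(t\xi)}F$ is differentiable in $\Sigma(E)$, and $$\frac{d}{dt}\mathcal K_{\exp(t\xi)}F=\mathcal L_\xi\mathcal K_{\exp(t\xi)}F=\mathcal K_{\exp(t\xi)}\mathcal L_\xi F .$$ 2. If $F$ is a section of class $C^1$, then $F\in D(\mathcal L_\zeta)$ for every $\zeta\in\mathrm{Lie}(G)$, and $\mathcal L_{\alpha\xi+\beta\eta}F=\alpha\mathcal L_\xi F+\beta\mathcal L_\eta F$. 3. If $F$ is a section of class $C^2$, then $F\in D(\mathcal L_\eta)$ and $\mathcal L_\eta F\in D(\mathcal L_\xi)$ for all $\xi,\eta\in\mathrm{Lie}(G)$, and $\mathcal L_{[\xi,\eta]}F=\mathcal L_\xi\mathcal L_\eta F-\mathcal L_\eta\mathcal L_\xi F$.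 Consequently, each $\mathcal L_\xi$ restricts to a linear operator on the space $C^\infty(\mathcal M,E)$ of smooth sections, and $\xi\mapsto\mathcal L_\xi$ is a representation of the Lie algebra $\mathrm{Lie}(G)$ on $C^\infty(\mathcal M,E)$. -/

import Mathlib

open Bundle Filter Topology
open scoped Manifold ContDiff

attribute [local instance] LieRing.ofAssociativeRing

noncomputable section

/-- The Lie bracket structure on `GroupLieAlgebra` is stated for groups of class
`minSmoothness ℝ 3`, which is `3`; a smooth real Lie group is of this class. -/
instance lieGroup_minSmoothness_three
    {EG : Type*} [NormedAddCommGroup EG] [NormedSpace ℝ EG]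
    {HG : Type*} [TopologicalSpace HG] (IG : ModelWithCorners ℝ EG HG)
    (G : Type*) [TopologicalSpace G] [ChartedSpace HG G] [Group G] [LieGroup IG ∞ G] :
    LieGroup IG (minSmoothness ℝ 3) G := by
  rw [minSmoothness_of_isRCLikeNormedField]
  infer_instance

/-- The exponential map of a Lie group: `exp ξ = γ 1`, where `γ : ℝ → G` is the (unique) integral
curve with `γ 0 = 1` of the left-invariant vector field with value `ξ` at the identity. (Such a
curve always exists on a boundaryless Lie group; the value `1` otherwise is a placeholder.) -/
def lieExp {EG : Type*} [NormedAddCommGroup EG] [NormedSpace ℝ EG]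
    {HG : Type*} [TopologicalSpace HG] (IG : ModelWithCorners ℝ EG HG)
    {G : Type*} [TopologicalSpace G] [ChartedSpace HG G] [Group G]
    (ξ : GroupLieAlgebra IG G) : G :=
  open Classical in
  if h : ∃ γ : ℝ → G, γ 0 = 1 ∧ IsMIntegralCurve (I := IG) γ (mulInvariantVectorField ξ) then
    h.choose 1
  else 1

/-- A smooth fiber-linear right action of the Lie group `G` on the total space of the smooth vector
bundle `E → M` (with model fiber `V`): a smooth map `Θ : E × G → E` that is a right action and such
that each `Θ_g` is a vector bundle homomorphism, i.e. covers a map `θ_g : M → M` and restricts to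
linear maps `E_p → E_{θ_g p}`. -/
structure FiberLinearRightAction
    {EG : Type*} [NormedAddCommGroup EG] [NormedSpace ℝ EG]
    {HG : Type*} [TopologicalSpace HG] (IG : ModelWithCorners ℝ EG HG)
    (G : Type*) [TopologicalSpace G] [ChartedSpace HG G] [Group G]
    {EM : Type*} [NormedAddCommGroup EM] [NormedSpace ℝ EM]
    {HM : Type*} [TopologicalSpace HM] (IM : ModelWithCorners ℝ EM HM)
    {M : Type*} [TopologicalSpace M] [ChartedSpace HM M]
    (V : Type*) [NormedAddCommGroup V] [NormedSpace ℝ V]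
    (E : M → Type*) [TopologicalSpace (TotalSpace V E)] [∀ p, TopologicalSpace (E p)]
    [∀ p, AddCommGroup (E p)] [∀ p, Module ℝ (E p)] [FiberBundle V E] where
  /-- The action map `Θ`. -/
  toFun : TotalSpace V E × G → TotalSpace V E
  contMDiff_toFun :
    ContMDiff ((IM.prod 𝓘(ℝ, V)).prod IG) (IM.prod 𝓘(ℝ, V)) ∞ toFun
  toFun_one : ∀ e : TotalSpace V E, toFun (e, 1) = e
  toFun_mul : ∀ (e : TotalSpace V E) (g h : G), toFun (toFun (e, g), h) = toFun (e, g * h)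
  fiberLinear : ∀ g : G, ∃ θg : M → M, ∀ p : M, ∃ A : E p →ₗ[ℝ] E (θg p),
    ∀ v : E p, toFun (⟨p, v⟩, g) = ⟨θg p, A v⟩

/-- Sections of class `C^m` of the vector bundle `E → M`. -/
def IsSectionOfClass {EM : Type*} [NormedAddCommGroup EM] [NormedSpace ℝ EM]
    {HM : Type*} [TopologicalSpace HM] (IM : ModelWithCorners ℝ EM HM)
    {M : Type*} [TopologicalSpace M] [ChartedSpace HM M]
    (V : Type*) [NormedAddCommGroup V] [NormedSpace ℝ V]
    {E : M → Type*} [TopologicalSpace (TotalSpace V E)] [∀ p, TopologicalSpace (E p)]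
    [FiberBundle V E] (m : ℕ∞ω) (F : ∀ p, E p) : Prop :=
  ContMDiff IM (IM.prod 𝓘(ℝ, V)) m (fun p => TotalSpace.mk' V p (F p))

/-- `c'` is the derivative at `t` of the curve `c` of (rough) sections, in the topology of pointwise
convergence, which is the product topology on `∀ p, E p`. -/
def HasSectionDerivAt {M : Type*} {E : M → Type*} [∀ p, TopologicalSpace (E p)]
    [∀ p, AddCommGroup (E p)] [∀ p, Module ℝ (E p)]
    (c : ℝ → ∀ p, E p) (c' : ∀ p, E p) (t : ℝ) : Prop :=
  Tendsto (fun s : ℝ => s⁻¹ • (c (t + s) - c t)) (𝓝[≠] 0) (𝓝 c')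

namespace FiberLinearRightAction

variable
    {EG : Type*} [NormedAddCommGroup EG] [NormedSpace ℝ EG]
    {HG : Type*} [TopologicalSpace HG] {IG : ModelWithCorners ℝ EG HG}
    {G : Type*} [TopologicalSpace G] [ChartedSpace HG G] [Group G]
    {EM : Type*} [NormedAddCommGroup EM] [NormedSpace ℝ EM]
    {HM : Type*} [TopologicalSpace HM] {IM : ModelWithCorners ℝ EM HM}
    {M : Type*} [TopologicalSpace M] [ChartedSpace HM M]
    {V : Type*} [NormedAddCommGroup V] [NormedSpace ℝ V]
    {E : M → Type*} [TopologicalSpace (TotalSpace V E)] [∀ p, TopologicalSpace (E p)]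
    [∀ p, AddCommGroup (E p)] [∀ p, Module ℝ (E p)] [FiberBundle V E]
    (Θ : FiberLinearRightAction IG G IM V E)

/-- The induced action `θ` on the base, `θ (p, g) = π (Θ (0_p, g))`. -/
def base (p : M) (g : G) : M := (Θ.toFun (⟨p, 0⟩, g)).proj

/-- `π ∘ Θ_g = θ_g ∘ π`. -/
theorem proj_toFun (e : TotalSpace V E) (g : G) : (Θ.toFun (e, g)).proj = Θ.base e.proj g := by
  obtain ⟨θg, hθ⟩ := Θ.fiberLinear g
  obtain ⟨A, hA⟩ := hθ e.proj
  have h1 : Θ.toFun (e, g) = ⟨θg e.proj, A e.2⟩ := hA e.2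
  have h2 : Θ.toFun (⟨e.proj, 0⟩, g) = ⟨θg e.proj, A 0⟩ := hA 0
  rw [base, h1, h2]

theorem proj_toFun_inv (p : M) (g : G) (v : E (Θ.base p g)) :
    (Θ.toFun (⟨Θ.base p g, v⟩, g⁻¹)).proj = p := by
  rw [proj_toFun]
  change Θ.base (Θ.base p g) g⁻¹ = p
  have h := Θ.toFun_mul ⟨p, 0⟩ g g⁻¹
  rw [mul_inv_cancel, Θ.toFun_one] at h
  have h' := congrArg TotalSpace.proj h
  rwa [proj_toFun] at h'

/-- The transformation operators `K_g F = Θ_{g⁻¹} ∘ F ∘ θ_g` on sections; the value at `p` is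
transported to the fiber over `p` along `θ_{g⁻¹} (θ_g p) = p`. -/
def transform (g : G) (F : ∀ p, E p) (p : M) : E p :=
  Θ.proj_toFun_inv p g (F (Θ.base p g)) ▸
    (Θ.toFun (⟨Θ.base p g, F (Θ.base p g)⟩, g⁻¹)).snd

/-- As a map into the total space, `K_g F` is `Θ_{g⁻¹} ∘ F ∘ θ_g`. -/
theorem mk_transform (g : G) (F : ∀ p, E p) (p : M) :
    (⟨p, Θ.transform g F p⟩ : TotalSpace V E) =
      Θ.toFun (⟨Θ.base p g, F (Θ.base p g)⟩, g⁻¹) := by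
  have key : ∀ (e : TotalSpace V E) (q : M) (h : e.proj = q),
      (⟨q, h ▸ e.snd⟩ : TotalSpace V E) = e := by
    rintro e _ rfl
    rfl
  exact key _ p (Θ.proj_toFun_inv p g (F (Θ.base p g)))

/-- The section `L` is the Lie derivative of `F` along `ξ`: the derivative at `t = 0` of
`t ↦ K_{exp(tξ)} F`. -/
def HasLieDeriv (ξ : GroupLieAlgebra IG G) (F L : ∀ p, E p) : Prop :=
  HasSectionDerivAt (fun t : ℝ => Θ.transform (lieExp IG (t • ξ)) F) L 0

/-- The domain `D(L_ξ)` of the Lie derivative. -/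
def lieDomain (ξ : GroupLieAlgebra IG G) : Set (∀ p, E p) := {F | ∃ L, Θ.HasLieDeriv ξ F L}

/-- The Lie derivative `L_ξ F`, with the placeholder value `0` if `F` is not in `D(L_ξ)`. -/
def lieDeriv (ξ : GroupLieAlgebra IG G) (F : ∀ p, E p) : ∀ p, E p :=
  open Classical in
  if h : ∃ L, Θ.HasLieDeriv ξ F L then h.choose else 0

end FiberLinearRightAction

end

/-!
Everything is reduced to calculus on the group. Fix a point `p` and consider the orbit function
`f_F : G → V`, `f_F g = (K_g F)(p)`, read in a trivialization at `p`.

* Left-invariant vector fields are complete, since left translates of one local integral curve are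
  integral curves, all of the same length. Hence `t ↦ exp(tξ)` is an integral curve and a
  one-parameter group (`isMIntegralCurve_lieExp_smul`, `lieExp_add_smul`).
* `K_g K_h = K_{gh}`, and each `K_g` is linear and continuous for pointwise convergence because it
  acts through continuous linear maps between fibers
  (`FiberLinearRightAction.exists_continuousLinearMap_transform`). So differentiability of
  `t ↦ K_{exp(tξ)} F` at `0` propagates to all times, with the expected derivative.
* If `F` is of class `C^m`, so is `f_F` (`FiberLinearRightAction.contMDiff_orbit`), and
  `L_ξ F (p)` is the derivative of `f_F` at `1` in the direction `ξ`, which is linear in `ξ`.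
* Applying the continuous operator `K_g` to the limit that defines `L_η F` shows that the orbit
  function of `L_η F` is `η f_F`, the derivative of `f_F` along the left-invariant field `η`
  (`FiberLinearRightAction.orbit_lieDeriv`). For `F` of class `C²` this is differentiable, hence
  `L_η F` is in the domain of `L_ξ`, without any regularity of `L_η F` along the base being needed,
  and `L_ξ L_η F (p) = (ξ η f_F)(1)`. The commutator formula is thus the fact that the bracket of
  vector fields on `G` is the commutator of derivations (`mvfderiv_mlieBracket`), which in a chart
  is the symmetry of second derivatives.
* If `F` is smooth, `(p, g) ↦ (K_g F)(p)` is smooth on `M × G`, and `L_ξ F` is one of its partial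
  derivatives, hence smooth (`FiberLinearRightAction.isSectionOfClass_lieDeriv`).
-/

/-! ### One-parameter subgroups -/

section Exp

variable {EG : Type*} [NormedAddCommGroup EG] [NormedSpace ℝ EG]
  {HG : Type*} [TopologicalSpace HG] {IG : ModelWithCorners ℝ EG HG}
  {G : Type*} [TopologicalSpace G] [ChartedSpace HG G] [Group G] [LieGroup IG ∞ G]

/-- `mulInvariantVectorField ξ` is invariant under left translations. -/
theorem mfderiv_mul_left_mulInvariantVectorField (ξ : GroupLieAlgebra IG G) (g h : G) :
    mfderiv IG IG (g * ·) h (mulInvariantVectorField ξ h) =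
      mulInvariantVectorField ξ (g * h) := by
  have e : (fun x : G => g * h * x) = (fun x => g * x) ∘ fun x => h * x := by
    ext x; simp [mul_assoc]
  have hd : ∀ a b : G, MDifferentiableAt IG IG (a * ·) b := fun a b =>
    (contMDiff_mul_left (I := IG) (n := ∞) (a := a)).mdifferentiableAt (by simp)
  have hc : mfderiv IG IG (fun x : G => g * h * x) 1 =
      (mfderiv IG IG (g * ·) h).comp (mfderiv IG IG (h * ·) (1 : G)) := by
    rw [e]
    refine (mfderiv_comp_of_eq (hd g h) (hd h 1) (mul_one h)).trans ?_
    rw [mul_one]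
  exact (DFunLike.congr_fun hc ξ).symm

theorem IsMIntegralCurveOn.mul_left {γ : ℝ → G} {ξ : GroupLieAlgebra IG G} {s : Set ℝ}
    (hγ : IsMIntegralCurveOn γ (mulInvariantVectorField ξ) s) (g : G) :
    IsMIntegralCurveOn (fun t => g * γ t) (mulInvariantVectorField ξ) s := by
  intro t ht
  have hd : HasMFDerivAt IG IG (g * ·) (γ t) (mfderiv IG IG (g * ·) (γ t)) :=
    ((contMDiff_mul_left (I := IG) (n := ∞) (a := g)).mdifferentiableAt (by simp)).hasMFDerivAt
  have h := hd.comp_hasMFDerivWithinAt t (hγ t ht)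
  refine h.congr_mfderiv ?_
  ext
  change mfderiv IG IG (g * ·) (γ t) ((1 : ℝ) • mulInvariantVectorField ξ (γ t)) =
    (1 : ℝ) • mulInvariantVectorField ξ (g * γ t)
  rw [one_smul, one_smul, mfderiv_mul_left_mulInvariantVectorField]

theorem IsMIntegralCurve.mul_left {γ : ℝ → G} {ξ : GroupLieAlgebra IG G}
    (hγ : IsMIntegralCurve γ (mulInvariantVectorField ξ)) (g : G) :
    IsMIntegralCurve (fun t => g * γ t) (mulInvariantVectorField ξ) := by
  rw [isMIntegralCurve_iff_isMIntegralCurveOn] at *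
  exact hγ.mul_left g

theorem contMDiff_one_mulInvariantVectorField (ξ : GroupLieAlgebra IG G) :
    ContMDiff IG IG.tangent 1
      (fun g : G => (⟨g, mulInvariantVectorField ξ g⟩ : TangentBundle IG G)) :=
  (contMDiff_mulInvariantVectorField ξ).of_le (le_trans (by norm_num) le_minSmoothness)

variable [IG.Boundaryless] [T2Space G] [CompleteSpace EG]

/-- The integral curve of a left-invariant vector field through the identity is global: a local integral curve through the
identity exists for some time `ε`, and by translation the same `ε` works at every point. -/
theorem exists_isMIntegralCurve_mulInvariantVectorField (ξ : GroupLieAlgebra IG G) :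
    ∃ γ : ℝ → G, γ 0 = 1 ∧ IsMIntegralCurve γ (mulInvariantVectorField ξ) := by
  have hv := contMDiff_one_mulInvariantVectorField ξ
  obtain ⟨γ, h0, hγ⟩ := exists_isMIntegralCurveAt_of_contMDiffAt_boundaryless 0
    (hv.contMDiffAt (x := (1 : G)))
  obtain ⟨ε, hε, hγ⟩ := isMIntegralCurveAt_iff'.1 hγ
  rw [Real.ball_eq_Ioo, zero_sub, zero_add] at hγ
  exact exists_isMIntegralCurve_of_isMIntegralCurveOn hv hε
    (fun g => ⟨fun t => g * γ t, by simp [h0], hγ.mul_left g⟩) 1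

theorem eq_lieExp_smul {γ : ℝ → G} {ξ : GroupLieAlgebra IG G} (h0 : γ 0 = 1)
    (hγ : IsMIntegralCurve γ (mulInvariantVectorField ξ)) (t : ℝ) :
    lieExp IG (t • ξ) = γ t := by
  have hex := exists_isMIntegralCurve_mulInvariantVectorField (t • ξ)
  have ht : IsMIntegralCurve (γ ∘ (· * t)) (mulInvariantVectorField (t • ξ)) := by
    rw [mulInvariantVectorField_smul]
    exact hγ.comp_mul t
  have he := isMIntegralCurve_Ioo_eq_of_contMDiff_boundaryless (t₀ := 0)
    (contMDiff_one_mulInvariantVectorField (t • ξ)) hex.choose_spec.2 ht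
    (by simp [h0, hex.choose_spec.1])
  rw [lieExp, dif_pos hex, he]
  simp

theorem isMIntegralCurve_lieExp_smul (ξ : GroupLieAlgebra IG G) :
    IsMIntegralCurve (fun t : ℝ => lieExp IG (t • ξ)) (mulInvariantVectorField ξ) := by
  obtain ⟨γ, h0, hγ⟩ := exists_isMIntegralCurve_mulInvariantVectorField ξ
  rwa [show (fun t : ℝ => lieExp IG (t • ξ)) = γ from funext (eq_lieExp_smul h0 hγ)]

theorem lieExp_zero_smul (ξ : GroupLieAlgebra IG G) : lieExp IG ((0 : ℝ) • ξ) = (1 : G) := by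
  obtain ⟨γ, h0, hγ⟩ := exists_isMIntegralCurve_mulInvariantVectorField ξ
  rw [eq_lieExp_smul h0 hγ, h0]

theorem lieExp_add_smul (ξ : GroupLieAlgebra IG G) (s t : ℝ) :
    lieExp IG ((s + t) • ξ) = lieExp IG (s • ξ) * lieExp IG (t • ξ) := by
  have h := isMIntegralCurve_lieExp_smul ξ
  have he := isMIntegralCurve_Ioo_eq_of_contMDiff_boundaryless (t₀ := 0)
    (contMDiff_one_mulInvariantVectorField ξ) (h.comp_add s) (h.mul_left (lieExp IG (s • ξ)))
    (by simp only [Function.comp_apply, zero_add, lieExp_zero_smul, mul_one])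
  have := congrFun he t
  rwa [Function.comp_apply, add_comm] at this

theorem IsMIntegralCurve.hasDerivAt_comp {HM : Type*} [TopologicalSpace HM] {EM : Type*}
    [NormedAddCommGroup EM] [NormedSpace ℝ EM] {I : ModelWithCorners ℝ EM HM}
    {M : Type*} [TopologicalSpace M] [ChartedSpace HM M] {W : Type*} [NormedAddCommGroup W]
    [NormedSpace ℝ W] {γ : ℝ → M} {v : Π x : M, TangentSpace I x} (hγ : IsMIntegralCurve γ v)
    {f : M → W} {t : ℝ} (hf : MDifferentiableAt I 𝓘(ℝ, W) f (γ t)) :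
    HasDerivAt (fun s => f (γ s)) (mvfderiv I f (γ t) (v (γ t))) t := by
  have h : HasFDerivAt (fun s => f (γ s)) ((mvfderiv I f (γ t)).comp
      (ContinuousLinearMap.smulRight (1 : ℝ →L[ℝ] ℝ) (v (γ t)))) t :=
    hasMFDerivAt_iff_hasFDerivAt.1 (hf.hasMFDerivAt.comp t (hγ t))
  refine h.hasDerivAt.congr_deriv ?_
  change mvfderiv I f (γ t) ((1 : ℝ) • v (γ t)) = _
  rw [one_smul]

/-- The derivative of a function on the group along the curve `t ↦ g exp(tξ)` is its derivative
along the left-invariant vector field `ξ`. -/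
theorem hasDerivAt_comp_mul_lieExp {W : Type*} [NormedAddCommGroup W] [NormedSpace ℝ W]
    {f : G → W} {g : G} (hf : MDifferentiableAt IG 𝓘(ℝ, W) f g) (ξ : GroupLieAlgebra IG G) :
    HasDerivAt (fun t : ℝ => f (g * lieExp IG (t • ξ)))
      (mvfderiv IG f g (mulInvariantVectorField ξ g)) 0 := by
  have h0 : g * lieExp IG ((0 : ℝ) • ξ) = g := by rw [lieExp_zero_smul, mul_one]
  have h := ((isMIntegralCurve_lieExp_smul ξ).mul_left g).hasDerivAt_comp (f := f) (t := 0)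
    (by rwa [h0])
  rwa [h0] at h

end Exp

/-! ### Lie brackets as commutators -/

section Bracket

open VectorField Set

variable {EM : Type*} [NormedAddCommGroup EM] [NormedSpace ℝ EM]
  {HM : Type*} [TopologicalSpace HM] {I : ModelWithCorners ℝ EM HM}
  {M : Type*} [TopologicalSpace M] [ChartedSpace HM M]
  {V : Type*} [NormedAddCommGroup V] [NormedSpace ℝ V]

/-- A vector field read in a chart keeps its value at the centre of the chart. -/
theorem mpullbackWithin_extChartAt_symm_self [IsManifold I 2 M]
    (Y : Π y : M, TangentSpace I y) (x : M) :
    mpullbackWithin 𝓘(ℝ, EM) I (extChartAt I x).symm Y (range I) (extChartAt I x x) = Y x := by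
  have : IsManifold I 1 M := .of_le (n := 2) (by norm_num)
  refine (mfderivWithin_extChartAt_symm_inverse_apply (x := x)
    (Y ((extChartAt I x).symm (extChartAt I x x)) : EM)).trans ?_
  exact congrArg (fun y => (Y y : EM)) (extChartAt_to_inv x)

variable [I.Boundaryless]

theorem mvfderiv_apply_eq_fderiv_extChartAt {f : M → V} {x : M}
    (hf : MDifferentiableAt I 𝓘(ℝ, V) f x)
    (v : TangentSpace I x) :
    mvfderiv I f x v = fderiv ℝ (f ∘ (extChartAt I x).symm) (extChartAt I x x) v := by
  have h := DFunLike.congr_fun hf.mvfderiv v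
  rw [I.range_eq_univ, fderivWithin_univ] at h
  exact h

variable [IsManifold I 2 M]

/-- The directional derivative of `f` along a vector field, read in a chart. -/
theorem mvfderiv_apply_extChartAt_symm {f : M → V} {x : M} {Y : Π y : M, TangentSpace I y} {z : EM}
    (hz : z ∈ (extChartAt I x).target)
    (hf : MDifferentiableAt I 𝓘(ℝ, V) f ((extChartAt I x).symm z)) :
    mvfderiv I f ((extChartAt I x).symm z) (Y ((extChartAt I x).symm z)) =
      fderiv ℝ (f ∘ (extChartAt I x).symm) z
        (mpullbackWithin 𝓘(ℝ, EM) I (extChartAt I x).symm Y (range I) z) := by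
  have : IsManifold I 1 M := .of_le (n := 2) (by norm_num)
  have hinv := isInvertible_mfderivWithin_extChartAt_symm (I := I) hz
  have hd : MDifferentiableAt 𝓘(ℝ, EM) I (extChartAt I x).symm z := by
    have := mdifferentiableWithinAt_extChartAt_symm (I := I) hz
    rwa [I.range_eq_univ, mdifferentiableWithinAt_univ] at this
  rw [I.range_eq_univ, mfderivWithin_univ] at hinv
  have hc := mfderiv_comp_apply z hf hd
    (mpullbackWithin 𝓘(ℝ, EM) I (extChartAt I x).symm Y (range I) z)
  rw [mfderiv_eq_fderiv] at hc
  refine Eq.trans ?_ hc.symm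
  rw [mpullbackWithin_apply, I.range_eq_univ, mfderivWithin_univ,
    ContinuousLinearMap.IsInvertible.self_apply_inverse hinv]
  rfl

variable [CompleteSpace EM]

/-- The derivative of `Y f` in direction `v`, for a `C²` function `f` and a differentiable vector
field `Y`, read in a chart: the product rule `D(Df · Y) v = D²f (v, Y) + Df (DY v)`. -/
theorem mdifferentiableAt_mvfderiv_apply {f : M → V} {x : M} {Y : Π y : M, TangentSpace I y}
    (hf : ContMDiffAt I 𝓘(ℝ, V) 2 f x)
    (hY : MDifferentiableAt I I.tangent (fun y => (Y y : TangentBundle I M)) x) :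
    MDifferentiableAt I 𝓘(ℝ, V) (fun y => mvfderiv I f y (Y y)) x ∧
      ∀ v : TangentSpace I x, mvfderiv I (fun y => mvfderiv I f y (Y y)) x v =
        fderiv ℝ (fderiv ℝ (f ∘ (extChartAt I x).symm)) (extChartAt I x x) v (Y x) +
        fderiv ℝ (f ∘ (extChartAt I x).symm) (extChartAt I x x)
          (fderiv ℝ (mpullbackWithin 𝓘(ℝ, EM) I (extChartAt I x).symm Y (range I))
            (extChartAt I x x) v) := by
  have : IsManifold I 1 M := .of_le (n := 2) (by norm_num)
  set φ := extChartAt I x with hφ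
  set u : EM → V := f ∘ φ.symm with hu
  set Z : EM → EM := mpullbackWithin 𝓘(ℝ, EM) I φ.symm Y (range I) with hZ
  have hu2 : ContDiffAt ℝ 2 u (φ x) := by
    have h := (contMDiffAt_iff.1 hf).2
    rw [I.range_eq_univ] at h
    exact h
  have hZd : DifferentiableAt ℝ Z (φ x) := by
    have h := (mdifferentiableWithinAt_univ.2 hY).differentiableWithinAt_mpullbackWithin_vectorField
    have hs : (extChartAt I x).symm ⁻¹' univ ∩ range I = univ := by
      rw [I.range_eq_univ, preimage_univ, univ_inter]
    rw [hs] at h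
    exact differentiableWithinAt_univ.1 h
  have hZx : Z (φ x) = Y x := mpullbackWithin_extChartAt_symm_self Y x
  have hu1 : DifferentiableAt ℝ (fderiv ℝ u) (φ x) :=
    (hu2.fderiv_right (m := 1) (by norm_num)).differentiableAt (by norm_num)
  have hK : HasFDerivAt (fun z => fderiv ℝ u z (Z z)) _ (φ x) :=
    hu1.hasFDerivAt.clm_apply hZd.hasFDerivAt
  have hfe : ∀ᶠ y in 𝓝 x, MDifferentiableAt I 𝓘(ℝ, V) f y :=
    ((contMDiffAt_iff_contMDiffAt_nhds (by simp)).1 hf).mono fun y hy =>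
      hy.mdifferentiableAt (by norm_num)
  have heq : (fun y => mvfderiv I f y (Y y)) =ᶠ[𝓝 x] (fun z => fderiv ℝ u z (Z z)) ∘ φ := by
    filter_upwards [hfe, extChartAt_source_mem_nhds (I := I) x] with y hy hys
    have h := mvfderiv_apply_extChartAt_symm (Y := Y) (φ.map_source hys)
      (by rwa [φ.left_inv hys])
    rwa [φ.left_inv hys] at h
  have hφd : HasMFDerivAt I 𝓘(ℝ, EM) φ x (ContinuousLinearMap.id ℝ _) := by
    rw [← mfderiv_extChartAt_self (I := I)]
    exact (mdifferentiableAt_extChartAt (mem_chart_source HM x)).hasMFDerivAt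
  have hD := (hK.hasMFDerivAt.comp x hφd).congr_of_eventuallyEq heq
  refine ⟨hD.mdifferentiableAt, fun v => ?_⟩
  refine (DFunLike.congr_fun hD.mfderiv v).trans ?_
  rw [← hZx, add_comm]
  rfl

/-- The Lie bracket of vector fields is the commutator of the associated derivations. -/
theorem mvfderiv_mlieBracket {f : M → V} {x : M} {X Y : Π y : M, TangentSpace I y}
    (hf : ContMDiffAt I 𝓘(ℝ, V) 2 f x)
    (hX : MDifferentiableAt I I.tangent (fun y => (X y : TangentBundle I M)) x)
    (hY : MDifferentiableAt I I.tangent (fun y => (Y y : TangentBundle I M)) x) :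
    mvfderiv I f x (mlieBracket I X Y x) =
      mvfderiv I (fun y => mvfderiv I f y (Y y)) x (X x) -
        mvfderiv I (fun y => mvfderiv I f y (X y)) x (Y x) := by
  have : IsManifold I 1 M := .of_le (n := 2) (by norm_num)
  have hu2 : ContDiffAt ℝ 2 (f ∘ (extChartAt I x).symm) (extChartAt I x x) := by
    have h := (contMDiffAt_iff.1 hf).2
    rw [I.range_eq_univ] at h
    exact h
  have hsymm := hu2.isSymmSndFDerivAt (by simp) (X x) (Y x)
  have hb : mlieBracket I X Y x =
      lieBracket ℝ (mpullbackWithin 𝓘(ℝ, EM) I (extChartAt I x).symm X (range I))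
        (mpullbackWithin 𝓘(ℝ, EM) I (extChartAt I x).symm Y (range I)) (extChartAt I x x) := by
    rw [← mlieBracketWithin_univ, mlieBracketWithin_apply, mfderiv_extChartAt_self]
    refine (DFunLike.congr_fun (ContinuousLinearMap.inverse_id (R := ℝ) (M := EM)) _).trans ?_
    have hs : (extChartAt I x).symm ⁻¹' univ ∩ range I = univ := by
      rw [I.range_eq_univ, preimage_univ, univ_inter]
    rw [hs]
    exact congrFun lieBracketWithin_univ _
  rw [(mdifferentiableAt_mvfderiv_apply hf hX).2, (mdifferentiableAt_mvfderiv_apply hf hY).2,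
    mvfderiv_apply_eq_fderiv_extChartAt (hf.mdifferentiableAt (by norm_num)), hb, hsymm]
  simp only [lieBracket, mpullbackWithin_extChartAt_symm_self]
  erw [map_sub]
  abel

end Bracket

/-! ### Differentiable curves of sections -/

section Curves

variable {M : Type*} [TopologicalSpace M] {V : Type*} [NormedAddCommGroup V] [NormedSpace ℝ V]
  {E : M → Type*} [TopologicalSpace (TotalSpace V E)] [∀ p, TopologicalSpace (E p)]
  [∀ p, AddCommGroup (E p)] [∀ p, Module ℝ (E p)] [FiberBundle V E] [VectorBundle ℝ V E]
  {c : ℝ → ∀ p, E p} {c' c'' : ∀ p, E p} {t : ℝ}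

theorem HasSectionDerivAt.hasDerivAt_trivialization (h : HasSectionDerivAt c c' t)
    (e : Trivialization V (π V E)) [MemTrivializationAtlas e] {p : M} (hp : p ∈ e.baseSet) :
    HasDerivAt (fun s => (e ⟨p, c s p⟩).2) (e ⟨p, c' p⟩).2 t := by
  rw [hasDerivAt_iff_tendsto_slope_zero]
  have hA := ((e.continuousLinearEquivAt ℝ p hp).continuous.tendsto (c' p)).comp
    (tendsto_pi_nhds.1 h p)
  refine hA.congr fun s => ?_
  simp only [Function.comp_apply, Pi.smul_apply, Pi.sub_apply, map_smul, map_sub]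
  rfl

/-- A curve of sections is differentiable for the topology of pointwise convergence if and only if
each of its values is differentiable as a curve in the model fiber. -/
theorem hasSectionDerivAt_iff : HasSectionDerivAt c c' t ↔ ∀ p, HasDerivAt
    (fun s => (trivializationAt V E p ⟨p, c s p⟩).2) (trivializationAt V E p ⟨p, c' p⟩).2 t := by
  refine ⟨fun h p => h.hasDerivAt_trivialization _ (mem_baseSet_trivializationAt V E p),
    fun h => tendsto_pi_nhds.2 fun p => ?_⟩
  have hp := h p
  rw [hasDerivAt_iff_tendsto_slope_zero] at hp
  set L := (trivializationAt V E p).continuousLinearEquivAt ℝ p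
    (mem_baseSet_trivializationAt V E p) with hL
  have hA := (L.symm.continuous.tendsto (L (c' p))).comp hp
  rw [L.symm_apply_apply] at hA
  refine hA.congr fun s => ?_
  change L.symm (s⁻¹ • (L (c (t + s) p) - L (c t p))) = s⁻¹ • (c (t + s) p - c t p)
  rw [← map_sub, ← map_smul, L.symm_apply_apply]

variable (V) in
include V in
/-- The fibers are Hausdorff, so derivatives of curves of sections are unique. -/
theorem HasSectionDerivAt.unique (h : HasSectionDerivAt c c' t) (h' : HasSectionDerivAt c c'' t) :
    c' = c'' := by
  funext p
  exact ((trivializationAt V E p).continuousLinearEquivAt ℝ p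
    (mem_baseSet_trivializationAt V E p)).injective
      ((hasSectionDerivAt_iff (V := V).1 h p).unique (hasSectionDerivAt_iff.1 h' p))

end Curves

namespace FiberLinearRightAction

/-! ### The transformation operators -/

section Transform

variable
    {EG : Type*} [NormedAddCommGroup EG] [NormedSpace ℝ EG]
    {HG : Type*} [TopologicalSpace HG] {IG : ModelWithCorners ℝ EG HG}
    {G : Type*} [TopologicalSpace G] [ChartedSpace HG G] [Group G]
    {EM : Type*} [NormedAddCommGroup EM] [NormedSpace ℝ EM]
    {HM : Type*} [TopologicalSpace HM] {IM : ModelWithCorners ℝ EM HM}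
    {M : Type*} [TopologicalSpace M] [ChartedSpace HM M]
    {V : Type*} [NormedAddCommGroup V] [NormedSpace ℝ V]
    {E : M → Type*} [TopologicalSpace (TotalSpace V E)] [∀ p, TopologicalSpace (E p)]
    [∀ p, AddCommGroup (E p)] [∀ p, Module ℝ (E p)] [FiberBundle V E]
    (Θ : FiberLinearRightAction IG G IM V E)

theorem base_mul (p : M) (g h : G) : Θ.base (Θ.base p g) h = Θ.base p (g * h) := by
  have := congrArg TotalSpace.proj (Θ.toFun_mul ⟨p, 0⟩ g h)
  rwa [proj_toFun, proj_toFun, proj_toFun] at this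

/-- The value of `K_g F` at `p` depends on the value of `F` at `θ_g p` only, through a continuous
linear map between the fibers. -/
theorem exists_continuousLinearMap_transform (g : G) (p : M) :
    ∃ A : E (Θ.base p g) →L[ℝ] E p, ∀ F : ∀ p, E p, Θ.transform g F p = A (F (Θ.base p g)) := by
  -- the point `θ_{g⁻¹} (θ_g p)` is only propositionally equal to `p`, so it is made a variable
  have key : ∀ q b : M, q = p → ∀ A : E b →ₗ[ℝ] E q,
      (∀ v : E b, Θ.toFun (⟨b, v⟩, g⁻¹) = ⟨q, A v⟩) →
      ∃ A : E b →L[ℝ] E p, ∀ v : E b, Θ.toFun (⟨b, v⟩, g⁻¹) = ⟨p, A v⟩ := by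
    rintro q b rfl A hA
    refine ⟨⟨A, ?_⟩, hA⟩
    change Continuous A
    rw [(FiberBundle.totalSpaceMk_isInducing V E q).continuous_iff]
    have h : Continuous fun v : E b => Θ.toFun (⟨b, v⟩, g⁻¹) :=
      Θ.contMDiff_toFun.continuous.comp
        ((FiberBundle.continuous_totalSpaceMk V E b).prodMk continuous_const)
    exact h.congr hA
  obtain ⟨θ, hθ⟩ := Θ.fiberLinear g⁻¹
  obtain ⟨A, hA⟩ := hθ (Θ.base p g)
  have hq : θ (Θ.base p g) = p := by
    have h := Θ.proj_toFun_inv p g 0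
    rwa [hA] at h
  obtain ⟨B, hB⟩ := key _ _ hq A hA
  refine ⟨B, fun F => ?_⟩
  have h := (Θ.mk_transform g F p).trans (hB _)
  exact TotalSpace.mk_inj.1 h

theorem transform_mul (g h : G) (F : ∀ p, E p) :
    Θ.transform (g * h) F = Θ.transform g (Θ.transform h F) := by
  funext p
  refine TotalSpace.mk_injective (F := V) p ?_
  rw [mk_transform, mk_transform, mk_transform, toFun_mul, mul_inv_rev, base_mul]

theorem transform_one (F : ∀ p, E p) : Θ.transform 1 F = F := by
  funext p
  refine TotalSpace.mk_injective (F := V) p ?_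
  have hb : Θ.base p 1 = p := by rw [base, toFun_one]
  rw [mk_transform, inv_one, toFun_one, hb]

theorem transform_add (g : G) (F F' : ∀ p, E p) :
    Θ.transform g (F + F') = Θ.transform g F + Θ.transform g F' := by
  funext p
  obtain ⟨A, hA⟩ := Θ.exists_continuousLinearMap_transform g p
  simp [hA]

theorem transform_smul (g : G) (a : ℝ) (F : ∀ p, E p) :
    Θ.transform g (a • F) = a • Θ.transform g F := by
  funext p
  obtain ⟨A, hA⟩ := Θ.exists_continuousLinearMap_transform g p
  simp [hA]

theorem hasSectionDerivAt_transform {c : ℝ → ∀ p, E p} {c' : ∀ p, E p} {t : ℝ}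
    (h : HasSectionDerivAt c c' t) (g : G) :
    HasSectionDerivAt (fun s => Θ.transform g (c s)) (Θ.transform g c') t := by
  refine tendsto_pi_nhds.2 fun p => ?_
  obtain ⟨A, hA⟩ := Θ.exists_continuousLinearMap_transform g p
  rw [hA]
  refine ((A.continuous.tendsto _).comp (tendsto_pi_nhds.1 h (Θ.base p g))).congr fun s => ?_
  simp [hA]

end Transform

end FiberLinearRightAction

namespace FiberLinearRightAction

section LieDerivative

variable
    {EG : Type*} [NormedAddCommGroup EG] [NormedSpace ℝ EG]
    {HG : Type*} [TopologicalSpace HG] {IG : ModelWithCorners ℝ EG HG}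
    {G : Type*} [TopologicalSpace G] [ChartedSpace HG G] [Group G]
    {EM : Type*} [NormedAddCommGroup EM] [NormedSpace ℝ EM]
    {HM : Type*} [TopologicalSpace HM] {IM : ModelWithCorners ℝ EM HM}
    {M : Type*} [TopologicalSpace M] [ChartedSpace HM M]
    {V : Type*} [NormedAddCommGroup V] [NormedSpace ℝ V]
    {E : M → Type*} [TopologicalSpace (TotalSpace V E)] [∀ p, TopologicalSpace (E p)]
    [∀ p, AddCommGroup (E p)] [∀ p, Module ℝ (E p)] [FiberBundle V E] [VectorBundle ℝ V E]
    (Θ : FiberLinearRightAction IG G IM V E)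

/-! ### Lie derivatives as limits -/

variable {Θ} in
theorem HasLieDeriv.lieDeriv_eq {ξ : GroupLieAlgebra IG G} {F L : ∀ p, E p}
    (h : Θ.HasLieDeriv ξ F L) : Θ.lieDeriv ξ F = L := by
  have hex : ∃ L, Θ.HasLieDeriv ξ F L := ⟨L, h⟩
  rw [lieDeriv, dif_pos hex]
  exact HasSectionDerivAt.unique V hex.choose_spec h

theorem hasLieDeriv_lieDeriv {ξ : GroupLieAlgebra IG G} {F : ∀ p, E p}
    (h : F ∈ Θ.lieDomain ξ) : Θ.HasLieDeriv ξ F (Θ.lieDeriv ξ F) := by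
  obtain ⟨L, hL⟩ := h
  rwa [hL.lieDeriv_eq]

variable {Θ} in
theorem HasLieDeriv.add {ξ : GroupLieAlgebra IG G} {F F' L L' : ∀ p, E p}
    (h : Θ.HasLieDeriv ξ F L) (h' : Θ.HasLieDeriv ξ F' L') :
    Θ.HasLieDeriv ξ (F + F') (L + L') := by
  refine (hasSectionDerivAt_iff (V := V)).2 fun p => ?_
  have hp := mem_baseSet_trivializationAt V E p
  have hadd := ((trivializationAt V E p).linear ℝ hp).map_add
  simp only [transform_add, Pi.add_apply, hadd]
  exact ((hasSectionDerivAt_iff (V := V)).1 h p).add ((hasSectionDerivAt_iff (V := V)).1 h' p)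

variable {Θ} in
theorem HasLieDeriv.const_smul {ξ : GroupLieAlgebra IG G} {F L : ∀ p, E p} (a : ℝ)
    (h : Θ.HasLieDeriv ξ F L) : Θ.HasLieDeriv ξ (a • F) (a • L) := by
  refine (hasSectionDerivAt_iff (V := V)).2 fun p => ?_
  have hp := mem_baseSet_trivializationAt V E p
  have hsmul := ((trivializationAt V E p).linear ℝ hp).map_smul
  simp only [transform_smul, Pi.smul_apply, hsmul]
  exact ((hasSectionDerivAt_iff (V := V)).1 h p).const_smul a

/-! ### Orbit functions -/

/-- The function `g ↦ (K_g F)(p)` on the group, read in the preferred trivialization at `p`. -/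
def orbit (F : ∀ p, E p) (p : M) (g : G) : V :=
  (trivializationAt V E p ⟨p, Θ.transform g F p⟩).2

/-- The value of the orbit function at the identity is `F p` in coordinates. -/
theorem ext_orbit {F F' : ∀ p, E p} (h : ∀ p, Θ.orbit F p 1 = Θ.orbit F' p 1) : F = F' := by
  funext p
  have h1 := h p
  rw [orbit, orbit, transform_one, transform_one] at h1
  exact ((trivializationAt V E p).continuousLinearEquivAt ℝ p
    (mem_baseSet_trivializationAt V E p)).injective h1

variable [LieGroup IG ∞ G]

/-! ### Regularity of orbit functions -/

/-- The transformed sections `K_g F` of a `C^m` section `F` depend on the point and on the group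
element in a `C^m` way. -/
theorem contMDiff_transform [IsManifold IM ∞ M] [ContMDiffVectorBundle ∞ V E IM] {m : ℕ∞ω}
    (hm : m ≤ ∞) {F : ∀ p, E p} (hF : IsSectionOfClass IM V m F) :
    ContMDiff (IM.prod IG) (IM.prod 𝓘(ℝ, V)) m
      (fun x : M × G => (⟨x.1, Θ.transform x.2 F x.1⟩ : TotalSpace V E)) := by
  have hΘ := Θ.contMDiff_toFun.of_le hm
  have hbase : ContMDiff (IM.prod IG) IM m (fun x : M × G => Θ.base x.1 x.2) := by
    have h0 : ContMDiff IM (IM.prod 𝓘(ℝ, V)) ∞ (zeroSection V E) := contMDiff_zeroSection ℝ E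
    exact (contMDiff_proj E).comp (hΘ.comp
      (((h0.of_le hm).comp contMDiff_fst).prodMk contMDiff_snd))
  have hinv : ContMDiff (IM.prod IG) IG m (fun x : M × G => x.2⁻¹) :=
    ((contMDiff_inv IG ∞).of_le hm).comp contMDiff_snd
  exact (hΘ.comp ((ContMDiff.comp hF hbase).prodMk hinv)).congr fun x => Θ.mk_transform _ _ _

theorem contMDiff_orbit [IsManifold IM ∞ M] [ContMDiffVectorBundle ∞ V E IM] {m : ℕ∞ω}
    (hm : m ≤ ∞) {F : ∀ p, E p} (hF : IsSectionOfClass IM V m F) (p : M) :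
    ContMDiff IG 𝓘(ℝ, V) m (Θ.orbit F p) := by
  have h : ContMDiff IG (IM.prod 𝓘(ℝ, V)) m
      (fun g : G => (⟨p, Θ.transform g F p⟩ : TotalSpace V E)) :=
    (Θ.contMDiff_transform hm hF).comp (contMDiff_const.prodMk contMDiff_id)
  exact fun g => (contMDiffAt_totalSpace.1 (h g)).2

variable [IG.Boundaryless] [T2Space G] [CompleteSpace EG]

/-! ### Lie derivatives and one-parameter subgroups -/

omit [VectorBundle ℝ V E] in
variable {Θ} in
/-- Since `K_{exp((t+s)ξ)} = K_{exp(tξ)} K_{exp(sξ)}`, differentiability of `t ↦ K_{exp(tξ)} F` at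
`0` propagates to every `t`. -/
theorem HasLieDeriv.hasSectionDerivAt {ξ : GroupLieAlgebra IG G} {F L : ∀ p, E p}
    (h : Θ.HasLieDeriv ξ F L) (t : ℝ) :
    HasSectionDerivAt (fun s : ℝ => Θ.transform (lieExp IG (s • ξ)) F)
      (Θ.transform (lieExp IG (t • ξ)) L) t := by
  refine (Θ.hasSectionDerivAt_transform h (lieExp IG (t • ξ))).congr fun s => ?_
  simp only [← transform_mul, ← lieExp_add_smul, zero_add, add_zero]

omit [VectorBundle ℝ V E] in
variable {Θ} in
theorem HasLieDeriv.transform {ξ : GroupLieAlgebra IG G} {F L : ∀ p, E p}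
    (h : Θ.HasLieDeriv ξ F L) (t : ℝ) :
    Θ.HasLieDeriv ξ (Θ.transform (lieExp IG (t • ξ)) F) (Θ.transform (lieExp IG (t • ξ)) L) := by
  refine (Θ.hasSectionDerivAt_transform h (lieExp IG (t • ξ))).congr fun s => ?_
  simp only [← transform_mul, ← lieExp_add_smul, add_comm t]

/-- If the orbit functions of `F` are differentiable at the identity, then `F` is in the domain of
every Lie derivative. -/
theorem mem_lieDomain_of_orbit {F : ∀ p, E p}
    (h : ∀ p, MDifferentiableAt IG 𝓘(ℝ, V) (Θ.orbit F p) 1) (ξ : GroupLieAlgebra IG G) :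
    F ∈ Θ.lieDomain ξ := by
  refine ⟨fun p => ((trivializationAt V E p).continuousLinearEquivAt ℝ p
    (mem_baseSet_trivializationAt V E p)).symm
      (mvfderiv IG (Θ.orbit F p) 1 (mulInvariantVectorField ξ 1)), ?_⟩
  refine (hasSectionDerivAt_iff (V := V)).2 fun p => ?_
  have h1 := hasDerivAt_comp_mul_lieExp (h p) ξ
  simp only [one_mul] at h1
  refine h1.congr_deriv ?_
  exact (((trivializationAt V E p).continuousLinearEquivAt ℝ p
    (mem_baseSet_trivializationAt V E p)).apply_symm_apply _).symm

/-- The orbit functions of `L_ξ F` are the derivatives of the orbit functions of `F` along the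
left-invariant vector field `ξ`. -/
theorem orbit_lieDeriv {F : ∀ p, E p} {p : M} {g : G}
    (h : MDifferentiableAt IG 𝓘(ℝ, V) (Θ.orbit F p) g) {ξ : GroupLieAlgebra IG G}
    (hF : F ∈ Θ.lieDomain ξ) :
    Θ.orbit (Θ.lieDeriv ξ F) p g =
      mvfderiv IG (Θ.orbit F p) g (mulInvariantVectorField ξ g) := by
  have h1 := (hasSectionDerivAt_iff (V := V)).1
    (Θ.hasSectionDerivAt_transform (Θ.hasLieDeriv_lieDeriv hF) g) p
  simp only [← transform_mul] at h1
  exact h1.unique (hasDerivAt_comp_mul_lieExp h ξ)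

end LieDerivative

end FiberLinearRightAction

/-! ### Smoothness of partial derivatives -/

/-- A partial derivative, at a fixed point and in a fixed direction, of a smooth function of two
variables depends smoothly on the other variable. -/
theorem contMDiffAt_mvfderiv_partial
    {EG : Type*} [NormedAddCommGroup EG] [NormedSpace ℝ EG]
    {HG : Type*} [TopologicalSpace HG] {IG : ModelWithCorners ℝ EG HG}
    {G : Type*} [TopologicalSpace G] [ChartedSpace HG G] [IsManifold IG ∞ G]
    {EM : Type*} [NormedAddCommGroup EM] [NormedSpace ℝ EM]
    {HM : Type*} [TopologicalSpace HM] {IM : ModelWithCorners ℝ EM HM}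
    {M : Type*} [TopologicalSpace M] [ChartedSpace HM M] [IsManifold IM ∞ M]
    {W : Type*} [NormedAddCommGroup W] [NormedSpace ℝ W] {ψ : M → G → W} {p : M} {g : G}
    (hψ : ContMDiffAt (IM.prod IG) 𝓘(ℝ, W) ∞ (Function.uncurry ψ) (p, g)) (v : TangentSpace IG g) :
    ContMDiffAt IM 𝓘(ℝ, W) ∞ (fun q => mvfderiv IG (ψ q) g v) p := by
  have : IsManifold IG 1 G := .of_le (n := ∞) (by simp)
  have h := ContMDiffAt.mfderiv (m := ∞) ψ (fun _ => g) hψ contMDiffAt_const (by simp)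
  obtain ⟨w, rfl⟩ : ∃ w : EG, w = v := ⟨v, rfl⟩
  refine (h.clm_apply (contMDiffAt_const (c := w))).congr_of_eventuallyEq
    (Eventually.of_forall fun q => ?_)
  -- the base point `g` is constant and `W` is a vector space, so the coordinate changes are trivial
  have hq : inTangentCoordinates IG 𝓘(ℝ, W) (fun _ : M => g) (fun x => ψ x g)
      (fun x => mfderiv IG 𝓘(ℝ, W) (ψ x) g) p q = mvfderiv IG (ψ q) g := by
    rw [inTangentCoordinates_eq_mfderiv_comp (mem_chart_source HG g)
        (by rw [chartAt_self_eq]; exact Set.mem_univ _),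
      mfderivWithin_range_extChartAt_symm]
    have hid : mfderiv 𝓘(ℝ, W) 𝓘(ℝ, W) (extChartAt 𝓘(ℝ, W) (ψ p g)) (ψ q g) =
        ContinuousLinearMap.id ℝ _ := by
      rw [extChartAt_self_eq]
      exact mfderiv_id
    rw [hid]
    rfl
  exact (DFunLike.congr_fun hq w).symm

namespace FiberLinearRightAction

section Smooth

variable
    {EG : Type*} [NormedAddCommGroup EG] [NormedSpace ℝ EG] [CompleteSpace EG]
    {HG : Type*} [TopologicalSpace HG] {IG : ModelWithCorners ℝ EG HG} [IG.Boundaryless]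
    {G : Type*} [TopologicalSpace G] [T2Space G] [ChartedSpace HG G] [Group G] [LieGroup IG ∞ G]
    {EM : Type*} [NormedAddCommGroup EM] [NormedSpace ℝ EM]
    {HM : Type*} [TopologicalSpace HM] {IM : ModelWithCorners ℝ EM HM}
    {M : Type*} [TopologicalSpace M] [ChartedSpace HM M] [IsManifold IM ∞ M]
    {V : Type*} [NormedAddCommGroup V] [NormedSpace ℝ V]
    {E : M → Type*} [TopologicalSpace (TotalSpace V E)] [∀ p, TopologicalSpace (E p)]
    [∀ p, AddCommGroup (E p)] [∀ p, Module ℝ (E p)] [FiberBundle V E] [VectorBundle ℝ V E]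
    [ContMDiffVectorBundle ∞ V E IM]
    (Θ : FiberLinearRightAction IG G IM V E)

/-! ### Lie derivatives of `C¹` and `C²` sections -/

theorem mem_lieDomain_of_isSectionOfClass_one {F : ∀ p, E p} (hF : IsSectionOfClass IM V 1 F)
    (ξ : GroupLieAlgebra IG G) : F ∈ Θ.lieDomain ξ :=
  Θ.mem_lieDomain_of_orbit
    (fun p => (Θ.contMDiff_orbit (by simp) hF p).mdifferentiable (by simp) 1) ξ

theorem lieDeriv_smul_add_smul {F : ∀ p, E p} (hF : IsSectionOfClass IM V 1 F)
    (ξ η : GroupLieAlgebra IG G) (α β : ℝ) :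
    Θ.lieDeriv (α • ξ + β • η) F = α • Θ.lieDeriv ξ F + β • Θ.lieDeriv η F := by
  have hd : ∀ p, MDifferentiableAt IG 𝓘(ℝ, V) (Θ.orbit F p) 1 := fun p =>
    (Θ.contMDiff_orbit (by simp) hF p).mdifferentiable (by simp) 1
  have hmem := Θ.mem_lieDomain_of_isSectionOfClass_one hF
  refine Θ.ext_orbit fun p => ?_
  have hl := (trivializationAt V E p).linear ℝ (mem_baseSet_trivializationAt V E p)
  have hr : Θ.orbit (α • Θ.lieDeriv ξ F + β • Θ.lieDeriv η F) p 1 =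
      α • Θ.orbit (Θ.lieDeriv ξ F) p 1 + β • Θ.orbit (Θ.lieDeriv η F) p 1 := by
    simp only [orbit, transform_add, transform_smul, Pi.add_apply, Pi.smul_apply, hl.map_add,
      hl.map_smul]
  rw [hr, Θ.orbit_lieDeriv (hd p) (hmem _), Θ.orbit_lieDeriv (hd p) (hmem _),
    Θ.orbit_lieDeriv (hd p) (hmem _), mulInvariantVectorField_add, mulInvariantVectorField_smul,
    mulInvariantVectorField_smul, Pi.add_apply, Pi.smul_apply, Pi.smul_apply, map_add, map_smul,
    map_smul]

/-- The orbit functions of `L_η F` are derivatives of `C²` functions on `G` along a smooth vector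
field, hence differentiable; this does not use that `L_η F` is a `C¹` section. -/
theorem lieDeriv_mem_lieDomain {F : ∀ p, E p} (hF : IsSectionOfClass IM V 2 F)
    (ξ η : GroupLieAlgebra IG G) : Θ.lieDeriv η F ∈ Θ.lieDomain ξ := by
  have h2 : (2 : ℕ∞ω) ≤ ∞ := ENat.LEInfty.out
  have : IsManifold IG 2 G := .of_le (n := ∞) h2
  refine Θ.mem_lieDomain_of_orbit (fun p => ?_) ξ
  have hc := Θ.contMDiff_orbit h2 hF p
  have heq : Θ.orbit (Θ.lieDeriv η F) p =
      fun g => mvfderiv IG (Θ.orbit F p) g (mulInvariantVectorField η g) :=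
    funext fun g => Θ.orbit_lieDeriv (hc.mdifferentiable (by simp) g)
      (Θ.mem_lieDomain_of_isSectionOfClass_one (hF.of_le (by norm_num)) η)
  rw [heq]
  exact (mdifferentiableAt_mvfderiv_apply (hc 1) (mdifferentiableAt_mulInvariantVectorField η)).1

theorem lieDeriv_lie {F : ∀ p, E p} (hF : IsSectionOfClass IM V 2 F)
    (ξ η : GroupLieAlgebra IG G) :
    Θ.lieDeriv ⁅ξ, η⁆ F =
      Θ.lieDeriv ξ (Θ.lieDeriv η F) - Θ.lieDeriv η (Θ.lieDeriv ξ F) := by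
  have h2 : (2 : ℕ∞ω) ≤ ∞ := ENat.LEInfty.out
  have : IsManifold IG 2 G := .of_le (n := ∞) h2
  have hF1 : IsSectionOfClass IM V 1 F := hF.of_le (by norm_num)
  refine Θ.ext_orbit fun p => ?_
  have hc := Θ.contMDiff_orbit h2 hF p
  have heq : ∀ ζ : GroupLieAlgebra IG G, Θ.orbit (Θ.lieDeriv ζ F) p =
      fun g => mvfderiv IG (Θ.orbit F p) g (mulInvariantVectorField ζ g) := fun ζ =>
    funext fun g => Θ.orbit_lieDeriv (hc.mdifferentiable (by simp) g)
      (Θ.mem_lieDomain_of_isSectionOfClass_one hF1 ζ)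
  have hX := fun ζ : GroupLieAlgebra IG G =>
    mdifferentiableAt_mulInvariantVectorField (I := IG) (g := (1 : G)) ζ
  have hd : ∀ ζ : GroupLieAlgebra IG G,
      MDifferentiableAt IG 𝓘(ℝ, V) (Θ.orbit (Θ.lieDeriv ζ F) p) 1 := fun ζ => by
    rw [heq]
    exact (mdifferentiableAt_mvfderiv_apply (hc 1) (hX ζ)).1
  have hl := (trivializationAt V E p).linear ℝ (mem_baseSet_trivializationAt V E p)
  have hr : ∀ L L' : ∀ p, E p, Θ.orbit (L - L') p 1 = Θ.orbit L p 1 - Θ.orbit L' p 1 := by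
    intro L L'
    rw [sub_eq_add_neg, ← neg_one_smul ℝ L']
    simp only [orbit, transform_add, transform_smul, Pi.add_apply, Pi.smul_apply, hl.map_add,
      hl.map_smul]
    rw [neg_one_smul, ← sub_eq_add_neg]
  rw [hr, heq, Θ.orbit_lieDeriv (hd η) (Θ.lieDeriv_mem_lieDomain hF ξ η),
    Θ.orbit_lieDeriv (hd ξ) (Θ.lieDeriv_mem_lieDomain hF η ξ), heq, heq,
    GroupLieAlgebra.bracket_def, mulInvariantVector_mlieBracket]
  exact mvfderiv_mlieBracket (hc 1) (hX ξ) (hX η)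

/-! ### Lie derivatives of smooth sections -/

/-- Near `p`, in a fixed trivialization, `L_ξ F` is the partial derivative at `g = 1` of the smooth
function `(q, g) ↦ (K_g F)(q)`. -/
theorem isSectionOfClass_lieDeriv {F : ∀ p, E p} (hF : IsSectionOfClass IM V ∞ F)
    (ξ : GroupLieAlgebra IG G) : IsSectionOfClass IM V ∞ (Θ.lieDeriv ξ F) := by
  intro p
  refine (contMDiffAt_section _).2 ?_
  set e := trivializationAt V E p with he
  set ψ : M → G → V := fun q g => (e ⟨q, Θ.transform g F q⟩).2 with hψ
  have hψd : ContMDiffAt (IM.prod IG) 𝓘(ℝ, V) ∞ (Function.uncurry ψ) (p, 1) :=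
    (contMDiffAt_totalSpace.1 (Θ.contMDiff_transform le_rfl hF (p, 1))).2
  refine (contMDiffAt_mvfderiv_partial hψd (mulInvariantVectorField ξ 1)).congr_of_eventuallyEq ?_
  have hF1 : IsSectionOfClass IM V 1 F := ContMDiff.of_le hF (by simp)
  -- `C¹` regularity, unlike `C^∞`, holds on a neighbourhood as soon as it holds at the point
  have h1 : ∀ᶠ x in 𝓝 (p, (1 : G)),
      ContMDiffAt (IM.prod IG) 𝓘(ℝ, V) 1 (Function.uncurry ψ) x :=
    (contMDiffAt_iff_contMDiffAt_nhds (by simp)).1 (hψd.of_le (by simp))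
  have h2 : ∀ᶠ q in 𝓝 p, ContMDiffAt (IM.prod IG) 𝓘(ℝ, V) 1 (Function.uncurry ψ) (q, 1) :=
    (continuous_id.prodMk continuous_const).tendsto p |>.eventually h1
  filter_upwards [h2, e.open_baseSet.mem_nhds (mem_baseSet_trivializationAt V E p)] with q hq hqe
  have hd : MDifferentiableAt IG 𝓘(ℝ, V) (ψ q) 1 :=
    (hq.comp (1 : G) (contMDiffAt_const.prodMk contMDiffAt_id)).mdifferentiableAt (by simp)
  have hder := hasDerivAt_comp_mul_lieExp hd ξ
  simp only [one_mul] at hder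
  exact (HasSectionDerivAt.hasDerivAt_trivialization (Θ.hasLieDeriv_lieDeriv
    (Θ.mem_lieDomain_of_isSectionOfClass_one hF1 ξ)) e hqe).unique hder

end Smooth

end FiberLinearRightAction

theorem mainTheorem6
    {EG : Type*} [NormedAddCommGroup EG] [NormedSpace ℝ EG] [FiniteDimensional ℝ EG]
    {HG : Type*} [TopologicalSpace HG] {IG : ModelWithCorners ℝ EG HG} [IG.Boundaryless]
    {G : Type*} [TopologicalSpace G] [T2Space G] [ChartedSpace HG G] [Group G] [LieGroup IG ∞ G]
    {EM : Type*} [NormedAddCommGroup EM] [NormedSpace ℝ EM] [FiniteDimensional ℝ EM]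
    {HM : Type*} [TopologicalSpace HM] {IM : ModelWithCorners ℝ EM HM} [IM.Boundaryless]
    {M : Type*} [TopologicalSpace M] [T2Space M] [ChartedSpace HM M] [IsManifold IM ∞ M]
    {V : Type*} [NormedAddCommGroup V] [NormedSpace ℝ V] [FiniteDimensional ℝ V]
    {E : M → Type*} [TopologicalSpace (TotalSpace V E)] [∀ p, TopologicalSpace (E p)]
    [∀ p, AddCommGroup (E p)] [∀ p, Module ℝ (E p)] [FiberBundle V E] [VectorBundle ℝ V E]
    [ContMDiffVectorBundle ∞ V E IM]
    (Θ : FiberLinearRightAction IG G IM V E) :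
    (∀ (ξ : GroupLieAlgebra IG G) (t : ℝ), ∀ F ∈ Θ.lieDomain ξ,
      Θ.transform (lieExp IG (t • ξ)) F ∈ Θ.lieDomain ξ ∧
      HasSectionDerivAt (fun s : ℝ => Θ.transform (lieExp IG (s • ξ)) F)
        (Θ.lieDeriv ξ (Θ.transform (lieExp IG (t • ξ)) F)) t ∧
      HasSectionDerivAt (fun s : ℝ => Θ.transform (lieExp IG (s • ξ)) F)
        (Θ.transform (lieExp IG (t • ξ)) (Θ.lieDeriv ξ F)) t ∧
      Θ.lieDeriv ξ (Θ.transform (lieExp IG (t • ξ)) F) =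
        Θ.transform (lieExp IG (t • ξ)) (Θ.lieDeriv ξ F)) ∧
    (∀ F : ∀ p, E p, IsSectionOfClass IM V 1 F →
      (∀ ξ : GroupLieAlgebra IG G, F ∈ Θ.lieDomain ξ) ∧
      ∀ (ξ η : GroupLieAlgebra IG G) (α β : ℝ),
        Θ.lieDeriv (α • ξ + β • η) F = α • Θ.lieDeriv ξ F + β • Θ.lieDeriv η F) ∧
    (∀ F : ∀ p, E p, IsSectionOfClass IM V 2 F →
      (∀ ξ η : GroupLieAlgebra IG G, F ∈ Θ.lieDomain η ∧ Θ.lieDeriv η F ∈ Θ.lieDomain ξ) ∧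
      ∀ ξ η : GroupLieAlgebra IG G,
        Θ.lieDeriv ⁅ξ, η⁆ F =
          Θ.lieDeriv ξ (Θ.lieDeriv η F) - Θ.lieDeriv η (Θ.lieDeriv ξ F)) ∧
    (haveI : CompleteSpace EG := FiniteDimensional.complete ℝ EG
      ∃ ρ : GroupLieAlgebra IG G →ₗ⁅ℝ⁆ Module.End ℝ (ContMDiffSection IM V ∞ E),
        ∀ (ξ : GroupLieAlgebra IG G) (F : ContMDiffSection IM V ∞ E),
          (F : ∀ p, E p) ∈ Θ.lieDomain ξ ∧ (ρ ξ F : ∀ p, E p) = Θ.lieDeriv ξ F) := by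
  have : CompleteSpace EG := FiniteDimensional.complete ℝ EG
  refine ⟨fun ξ t F hF => ?_, fun F hF => ⟨Θ.mem_lieDomain_of_isSectionOfClass_one hF,
    Θ.lieDeriv_smul_add_smul hF⟩, fun F hF => ⟨fun ξ η =>
      ⟨Θ.mem_lieDomain_of_isSectionOfClass_one (hF.of_le (by norm_num)) η,
        Θ.lieDeriv_mem_lieDomain hF ξ η⟩, Θ.lieDeriv_lie hF⟩, ?_⟩
  · have hL := Θ.hasLieDeriv_lieDeriv hF
    have ht := hL.transform t
    rw [ht.lieDeriv_eq]
    exact ⟨⟨_, ht⟩, hL.hasSectionDerivAt t, hL.hasSectionDerivAt t, rfl⟩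
  · have h1 : ∀ F : ContMDiffSection IM V ∞ E, IsSectionOfClass IM V 1 (F : ∀ p, E p) :=
      fun F => F.contMDiff.of_le (by simp)
    have h2 : ∀ F : ContMDiffSection IM V ∞ E, IsSectionOfClass IM V 2 (F : ∀ p, E p) :=
      fun F => F.contMDiff.of_le (ENat.LEInfty.out)
    have hmem := fun F ξ => Θ.mem_lieDomain_of_isSectionOfClass_one (h1 F) ξ
    let D : GroupLieAlgebra IG G → Module.End ℝ (ContMDiffSection IM V ∞ E) := fun ξ =>
      { toFun := fun F => ⟨Θ.lieDeriv ξ F, Θ.isSectionOfClass_lieDeriv F.contMDiff ξ⟩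
        map_add' := fun F F' => DFunLike.coe_injective
          ((Θ.hasLieDeriv_lieDeriv (hmem F ξ)).add (Θ.hasLieDeriv_lieDeriv (hmem F' ξ))).lieDeriv_eq
        map_smul' := fun a F => DFunLike.coe_injective
          ((Θ.hasLieDeriv_lieDeriv (hmem F ξ)).const_smul a).lieDeriv_eq }
    refine ⟨{ toFun := D, map_add' := fun ξ η => ?_, map_smul' := fun a ξ => ?_,
              map_lie' := fun {ξ η} => ?_ }, fun ξ F => ⟨hmem F ξ, rfl⟩⟩
    · refine LinearMap.ext fun F => DFunLike.coe_injective ?_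
      have h := Θ.lieDeriv_smul_add_smul (h1 F) ξ η 1 1
      rwa [one_smul, one_smul, one_smul, one_smul] at h
    · refine LinearMap.ext fun F => DFunLike.coe_injective ?_
      have h := Θ.lieDeriv_smul_add_smul (h1 F) ξ 0 a 0
      rwa [zero_smul, zero_smul, add_zero, add_zero] at h
    · exact LinearMap.ext fun F => DFunLike.coe_injective (Θ.lieDeriv_lie (h2 F) ξ η)
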